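/- Let $\mathcal U$ be a class of individuals and let $\mathbf V[\mathcal U]$ be the class of well-founded sets over $\mathcal U$. A *skand* $X_{(\alpha_0,\alpha)}$, for ordinals $\alpha_0<\alpha$, is a family $(X_{\alpha'})_{\alpha_0\le\alpha'<\alpha}$ of (possibly empty) sets $X_{\alpha'}\in\mathbf V[\mathcal U]$, its components. Two skands $X_{(\alpha_0,\alpha)}$, $Y_{(\beta_0,\beta)}$ are *equal* if there is an order isomorphism $\varphi$ from $\{\alpha' : \alpha_0\le\alpha'<\alpha\}$ onto $\{\beta' : \beta_0\le\beta'<\beta\}$ with $X_{\alpha'}=Y_{\varphi(\alpha')}$ for all $\alpha'$. For $\alpha_0\le\alpha_1<\alpha$, $X_{(\alpha_1,\alpha)}$ denotes the skand with the components $X_{\alpha'}$, $\alpha_1\le\alpha'<\alpha$; the skand is *self-similar* if $X_{(\alpha_0,\alpha)}=X_{(\alpha_1,\alpha)}$ for all such $\alpha_1$. A skand of infinite length is regarded as the set whose elements are the elements of $X_{\alpha_0}$ together with the skand $X_{(\alpha_0+1,\alpha)}$; skands of infinite length are equal as sets if and only if they are equal as skands. Let $\mathbf V[\mathcal U]^{(1)}$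 be the universe of sets without foundation generated by the individuals, the well-founded sets and all skands, where elements that are not individuals are equal if they have the same elements. Let $\mathbf V[\mathcal U]^-$ be any universe of sets with the individuals $\mathcal U$ and without the axiom of foundation (extensional for sets; a class is a set if and only if it is small) that contains $\mathbf V[\mathcal U]^{(1)}$ as a transitive part; $\mathbf V[\mathcal U]^{(1)}$ itself is one. **Proposition 1.** Reflexive sets, i.e. sets $X$ with $X\in X$, exist in $\mathbf V[\mathcal U]^{(1)}$ and in every such $\mathbf V[\mathcal U]^-$. Moreover, for every set $A=\{x_0,x_1,\dots,x_\lambda,\dots\}\in\mathbf V[\mathcal U]$: 1. the solutions $X$ in $\mathbf V[\mathcal U]^-$ of the equation $$X=\{x_0,x_1,\dots,x_\lambda,\dots,X\}$$ (that is, $X=A\cup\{X\}$) form a proper class; 2. for each ordinal $\kappa\ge1$ the skand $X_{(0,\omega^\kappa)}$ all of whose components are equal to $A$ is self-similar and is a solution of this equation; 3. for different $\kappa\ge1$ these solutions are different. -/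

import Mathlib

universe u

namespace Skands

/-! ### Well-founded sets over a class of individuals

Sets are `u`-small collections, classes are arbitrary subsets of types in `Type (u + 1)`. -/

/-- Well-founded membership trees whose leaves may carry individuals from the class `A`. -/
inductive PreHSet (A : Type (u + 1)) : Type (u + 1)
  | atom (a : A) : PreHSet A
  | set (ι : Type u) (f : ι → PreHSet A) : PreHSet A

namespace PreHSet

variable {A : Type (u + 1)}

/-- Iterated extensional equality. -/
def Equiv : PreHSet A → PreHSet A → Prop
  | atom a, atom b => a = b
  | set _ f, set _ g =>
      (∀ i, ∃ k, Equiv (f i) (g k)) ∧ (∀ k, ∃ i, Equiv (f i) (g k))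
  | atom _, set _ _ => False
  | set _ _, atom _ => False

theorem Equiv.refl : ∀ x : PreHSet A, Equiv x x
  | atom _ => rfl
  | set _ f => ⟨fun i => ⟨i, Equiv.refl (f i)⟩, fun i => ⟨i, Equiv.refl (f i)⟩⟩

theorem Equiv.symm : ∀ {x y : PreHSet A}, Equiv x y → Equiv y x
  | atom _, atom _, h => Eq.symm h
  | set _ _, set _ _, h =>
      ⟨fun k => (h.2 k).imp fun _ hi => Equiv.symm hi,
        fun i => (h.1 i).imp fun _ hi => Equiv.symm hi⟩

theorem Equiv.trans : ∀ {x y z : PreHSet A}, Equiv x y → Equiv y z → Equiv x z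
  | atom _, atom _, atom _, h, h' => Eq.trans h h'
  | set _ _, set _ _, set _ _, h, h' =>
      ⟨fun i => let ⟨k, hk⟩ := h.1 i; let ⟨l, hl⟩ := h'.1 k; ⟨l, Equiv.trans hk hl⟩,
        fun l => let ⟨k, hk⟩ := h'.2 l; let ⟨i, hi⟩ := h.2 k; ⟨i, Equiv.trans hi hk⟩⟩

instance setoid (A : Type (u + 1)) : Setoid (PreHSet A) :=
  ⟨Equiv, Equiv.refl, Equiv.symm, Equiv.trans⟩

/-- Renaming of the individuals. -/
def map {B : Type (u + 1)} (φ : A → B) : PreHSet A → PreHSet B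
  | atom a => atom (φ a)
  | set ι f => set ι fun i => map φ (f i)

theorem Equiv.map {B : Type (u + 1)} (φ : A → B) :
    ∀ {x y : PreHSet A}, Equiv x y → Equiv (x.map φ) (y.map φ)
  | atom _, atom _, h => congrArg φ h
  | set _ _, set _ _, h =>
      ⟨fun i => (h.1 i).imp fun _ hk => Equiv.map φ hk,
        fun k => (h.2 k).imp fun _ hi => Equiv.map φ hi⟩

end PreHSet

/-- The universal class of well-founded set theory with individuals `A`: its members are the
individuals `a : A` and the well-founded sets built from them. -/
def HSet (A : Type (u + 1)) : Type (u + 1) := Quotient (PreHSet.setoid A)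

namespace HSet

variable {A : Type (u + 1)}

/-- An individual. -/
def atom (a : A) : HSet A := Quotient.mk _ (PreHSet.atom a)

/-- The set of all `f i`. -/
noncomputable def mk (ι : Type u) (f : ι → HSet A) : HSet A :=
  Quotient.mk _ (PreHSet.set ι fun i => (f i).out)

/-- `x` is a set, not an individual. -/
def IsSet (x : HSet A) : Prop := ∃ (ι : Type u) (f : ι → HSet A), x = mk ι f

/-- Membership; individuals have no members. -/
def Mem (y x : HSet A) : Prop := ∃ (ι : Type u) (f : ι → HSet A), x = mk ι f ∧ ∃ i, y = f i

/-- Renaming of the individuals; for an injective renaming this is the inclusion of universes. -/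
def map {B : Type (u + 1)} (φ : A → B) : HSet A → HSet B :=
  Quotient.map (PreHSet.map φ) fun _ _ h => PreHSet.Equiv.map φ h

theorem mk_quot (ι : Type u) (f : ι → PreHSet A) :
    (Quotient.mk (PreHSet.setoid A) (PreHSet.set ι f) : HSet A) =
      mk ι fun i => Quotient.mk _ (f i) :=
  Quotient.sound ⟨fun i => ⟨i, PreHSet.Equiv.symm (Quotient.mk_out (s := PreHSet.setoid A) (f i))⟩,
    fun i => ⟨i, PreHSet.Equiv.symm (Quotient.mk_out (s := PreHSet.setoid A) (f i))⟩⟩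

theorem mk_eq_mk {ι κ : Type u} {f : ι → HSet A} {g : κ → HSet A} :
    mk ι f = mk κ g ↔ (∀ i, ∃ k, f i = g k) ∧ (∀ k, ∃ i, f i = g k) := by
  have key : ∀ i k, PreHSet.Equiv (f i).out (g k).out ↔ f i = g k := fun i k =>
    (Quotient.out_equiv_out (s := PreHSet.setoid A))
  constructor
  · intro h
    have h' := Quotient.exact h
    exact ⟨fun i => (h'.1 i).imp fun k => (key i k).1, fun k => (h'.2 k).imp fun i => (key i k).1⟩
  · intro h
    exact Quotient.sound
      ⟨fun i => (h.1 i).imp fun k => (key i k).2, fun k => (h.2 k).imp fun i => (key i k).2⟩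

theorem atom_ne_mk (a : A) (ι : Type u) (f : ι → HSet A) : atom a ≠ mk ι f :=
  fun h => Quotient.exact h

theorem atom_injective : Function.Injective (atom : A → HSet A) :=
  fun _ _ h => Quotient.exact h

theorem atom_or_mk (x : HSet A) : (∃ a, x = atom a) ∨ x.IsSet := by
  induction x using Quotient.inductionOn with
  | _ x =>
    cases x with
    | atom a => exact Or.inl ⟨a, rfl⟩
    | set ι f => exact Or.inr ⟨ι, _, mk_quot ι f⟩

theorem mem_mk {ι : Type u} {f : ι → HSet A} {y : HSet A} : Mem y (mk ι f) ↔ ∃ i, y = f i := by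
  constructor
  · rintro ⟨κ, g, h, k, rfl⟩
    obtain ⟨i, hi⟩ := (mk_eq_mk.1 h).2 k
    exact ⟨i, hi.symm⟩
  · rintro ⟨i, rfl⟩
    exact ⟨ι, f, rfl, i, rfl⟩

theorem not_mem_atom (a : A) (y : HSet A) : ¬ Mem y (atom a) :=
  fun ⟨ι, f, h, _⟩ => atom_ne_mk a ι f h

theorem ext_of_isSet {x y : HSet A} (hx : x.IsSet) (hy : y.IsSet)
    (h : ∀ z, Mem z x ↔ Mem z y) : x = y := by
  obtain ⟨ι, f, rfl⟩ := hx
  obtain ⟨κ, g, rfl⟩ := hy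
  refine mk_eq_mk.2 ⟨fun i => mem_mk.1 ((h _).1 (mem_mk.2 ⟨i, rfl⟩)), fun k => ?_⟩
  obtain ⟨i, hi⟩ := mem_mk.1 ((h _).2 (mem_mk.2 ⟨k, rfl⟩))
  exact ⟨i, hi.symm⟩

theorem small_mem (x : HSet A) : Small.{u} {y | Mem y x} := by
  rcases atom_or_mk x with ⟨a, rfl⟩ | ⟨ι, f, rfl⟩
  · have : {y | Mem y (atom a)} = (∅ : Set (HSet A)) :=
      Set.eq_empty_of_forall_notMem fun y => not_mem_atom a y
    rw [this]
    infer_instance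
  · have : {y | Mem y (mk ι f)} = Set.range f := by
      ext y
      simp [mem_mk, eq_comm]
    rw [this]
    infer_instance

theorem exists_of_small (C : Set (HSet A)) [Small.{u} C] :
    ∃ x : HSet A, x.IsSet ∧ ∀ y, Mem y x ↔ y ∈ C := by
  refine ⟨mk (Shrink.{u} C) fun i => ((equivShrink C).symm i : HSet A), ⟨_, _, rfl⟩, fun y => ?_⟩
  rw [mem_mk]
  constructor
  · rintro ⟨i, rfl⟩
    exact ((equivShrink C).symm i).2
  · intro hy
    exact ⟨equivShrink C ⟨y, hy⟩, by simp⟩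

theorem induction {P : HSet A → Prop} (ha : ∀ a, P (atom a))
    (hs : ∀ x, x.IsSet → (∀ y, Mem y x → P y) → P x) (x : HSet A) : P x := by
  induction x using Quotient.inductionOn with
  | _ x =>
    induction x with
    | atom a => exact ha a
    | set ι f ih =>
      rw [mk_quot]
      refine hs _ ⟨_, _, rfl⟩ fun y hy => ?_
      obtain ⟨i, rfl⟩ := mem_mk.1 hy
      exact ih i

theorem map_atom {B : Type (u + 1)} (φ : A → B) (a : A) : (atom a).map φ = atom (φ a) := rfl

theorem map_mk {B : Type (u + 1)} (φ : A → B) (ι : Type u) (f : ι → HSet A) :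
    (mk ι f).map φ = mk ι fun i => (f i).map φ := by
  have h : (mk ι f).map φ =
      (Quotient.mk _ (PreHSet.set ι fun i => PreHSet.map φ (f i).out) : HSet B) := rfl
  rw [h, mk_quot]
  refine congrArg (mk ι) (funext fun i => ?_)
  conv_rhs => rw [← Quotient.out_eq (f i)]
  rfl

theorem isSet_map {B : Type (u + 1)} (φ : A → B) {x : HSet A} (hx : x.IsSet) :
    (x.map φ).IsSet := by
  obtain ⟨ι, f, rfl⟩ := hx
  exact ⟨_, _, map_mk φ ι f⟩

theorem mem_map {B : Type (u + 1)} (φ : A → B) {x : HSet A} {y : HSet B} :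
    Mem y (x.map φ) ↔ ∃ z, Mem z x ∧ y = z.map φ := by
  rcases atom_or_mk x with ⟨a, rfl⟩ | ⟨ι, f, rfl⟩
  · rw [map_atom]
    exact ⟨fun h => (not_mem_atom _ _ h).elim, fun ⟨z, hz, _⟩ => (not_mem_atom _ _ hz).elim⟩
  · rw [map_mk, mem_mk]
    constructor
    · rintro ⟨i, rfl⟩
      exact ⟨_, mem_mk.2 ⟨i, rfl⟩, rfl⟩
    · rintro ⟨z, hz, rfl⟩
      obtain ⟨i, rfl⟩ := mem_mk.1 hz
      exact ⟨i, rfl⟩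

theorem map_injective {B : Type (u + 1)} {φ : A → B} (hφ : Function.Injective φ) :
    Function.Injective (map φ) := by
  intro x
  induction x using HSet.induction with
  | ha a =>
    intro y h
    rcases atom_or_mk y with ⟨b, rfl⟩ | hy
    · exact congrArg atom (hφ (atom_injective h))
    · obtain ⟨ι, f, e⟩ := isSet_map φ hy
      exact (atom_ne_mk _ _ _ (h.trans e)).elim
  | hs x hx ih =>
    intro y h
    rcases atom_or_mk y with ⟨b, rfl⟩ | hy
    · obtain ⟨ι, f, e⟩ := isSet_map φ hx
      exact (atom_ne_mk _ _ _ (h.symm.trans e)).elim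
    · refine ext_of_isSet hx hy fun z => ⟨fun hz => ?_, fun hz => ?_⟩
      · have : Mem (z.map φ) (y.map φ) := h ▸ (mem_map φ).2 ⟨z, hz, rfl⟩
        obtain ⟨w, hw, e⟩ := (mem_map φ).1 this
        rwa [ih z hz e]
      · have : Mem (z.map φ) (x.map φ) := h ▸ (mem_map φ).2 ⟨z, hz, rfl⟩
        obtain ⟨w, hw, e⟩ := (mem_map φ).1 this
        rwa [← ih w hw e.symm]

end HSet

/-- The class of all well-founded sets over the individuals `U` (individuals excluded). -/
def WFSet (U : Type (u + 1)) : Type (u + 1) := {x : HSet U // x.IsSet}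

/-! ### Skands -/

/-- A skand `X_(lo, hi)`: a system of embedded braces indexed by the ordinals
`lo ≤ i < hi`, together with its components, which are (possibly empty) well-founded sets. -/
structure Skand (U : Type (u + 1)) : Type (u + 1) where
  lo : Ordinal.{u}
  hi : Ordinal.{u}
  lo_lt_hi : lo < hi
  comp : Set.Ico lo hi → WFSet U

namespace Skand

variable {U : Type (u + 1)}

/-- Equality of skands: the index segments are isomorphic as well-ordered sets, and corresponding
components are equal sets. -/
def Equal (X Y : Skand U) : Prop :=
  ∃ φ : Set.Ico X.lo X.hi ≃o Set.Ico Y.lo Y.hi, ∀ i, X.comp i = Y.comp (φ i)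

/-- The skand `X_(a, hi)` with the same components as `X` from the index `a` on. -/
def tail (X : Skand U) (a : Ordinal.{u}) (h₀ : X.lo ≤ a) (h₁ : a < X.hi) : Skand U where
  lo := a
  hi := X.hi
  lo_lt_hi := h₁
  comp i := X.comp ⟨i.1, h₀.trans i.2.1, i.2.2⟩

/-- A skand is self-similar if it is equal to all of its tails. -/
def IsSelfSimilar (X : Skand U) : Prop :=
  ∀ (a : Ordinal.{u}) (h₀ : X.lo ≤ a) (h₁ : a < X.hi), X.Equal (X.tail a h₀ h₁)

/-- The length of the skand is at least `ω`. -/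
def IsInfinite (X : Skand U) : Prop := X.lo + Ordinal.omega0 ≤ X.hi

/-- The first component. -/
def head (X : Skand U) : WFSet U := X.comp ⟨X.lo, le_rfl, X.lo_lt_hi⟩

/-- The skand `X_(0, a)` all of whose components are equal to `A`. -/
def const (A : WFSet U) (a : Ordinal.{u}) (ha : 0 < a) : Skand U where
  lo := 0
  hi := a
  lo_lt_hi := ha
  comp _ := A

end Skand

/-- Skands of infinite length, before identification of equal ones. -/
def PreInfSkand (U : Type (u + 1)) : Type (u + 1) := {X : Skand U // X.IsInfinite}

instance PreInfSkand.setoid (U : Type (u + 1)) : Setoid (PreInfSkand U) where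
  r X Y := X.1.Equal Y.1
  iseqv :=
    { refl := fun _ => ⟨OrderIso.refl _, fun _ => rfl⟩
      symm := fun ⟨φ, h⟩ => ⟨φ.symm, fun i => by rw [h]; simp⟩
      trans := fun ⟨φ, h⟩ ⟨ψ, h'⟩ => ⟨φ.trans ψ, fun i => by rw [h, h']; rfl⟩ }

/-- The class of all skands of infinite length, equal skands being identified. -/
def InfSkand (U : Type (u + 1)) : Type (u + 1) := Quotient (PreInfSkand.setoid U)

/-- The tail `X_(lo + 1, hi)` of a skand of infinite length. -/
def PreInfSkand.next {U : Type (u + 1)} (X : PreInfSkand U) : PreInfSkand U :=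
  ⟨X.1.tail (X.1.lo + 1) le_self_add
      (lt_of_lt_of_le (add_lt_add_right Ordinal.one_lt_omega0 _) X.2),
    by
      change X.1.lo + 1 + Ordinal.omega0 ≤ X.1.hi
      rw [add_assoc, Ordinal.one_add_omega0]
      exact X.2⟩

theorem Skand.Equal.apply_lo {U : Type (u + 1)} {X Y : Skand U}
    (φ : Set.Ico X.lo X.hi ≃o Set.Ico Y.lo Y.hi) :
    φ ⟨X.lo, le_rfl, X.lo_lt_hi⟩ = ⟨Y.lo, le_rfl, Y.lo_lt_hi⟩ := by
  apply le_antisymm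
  · rw [← φ.le_symm_apply]
    exact (φ.symm _).2.1
  · exact (φ _).2.1

theorem PreInfSkand.head_eq {U : Type (u + 1)} {X Y : PreInfSkand U} (h : X.1.Equal Y.1) :
    X.1.head = Y.1.head := by
  obtain ⟨φ, h⟩ := h
  rw [Skand.head, h, Skand.Equal.apply_lo φ, Skand.head]

theorem PreInfSkand.next_equal {U : Type (u + 1)} {X Y : PreInfSkand U} (h : X.1.Equal Y.1) :
    X.next.1.Equal Y.next.1 := by
  obtain ⟨φ, h⟩ := h
  have key : ∀ {X Y : Skand U} (φ : Set.Ico X.lo X.hi ≃o Set.Ico Y.lo Y.hi)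
      (i : Set.Ico X.lo X.hi), X.lo + 1 ≤ i.1 → Y.lo + 1 ≤ (φ i).1 := by
    intro X Y φ i hi
    rw [Order.add_one_le_iff] at hi ⊢
    have : φ ⟨X.lo, le_rfl, X.lo_lt_hi⟩ < φ i := φ.lt_iff_lt.2 hi
    rwa [Skand.Equal.apply_lo φ] at this
  let f : Set.Ico (X.1.lo + 1) X.1.hi → Set.Ico (Y.1.lo + 1) Y.1.hi := fun i =>
    ⟨(φ ⟨i.1, le_self_add.trans i.2.1, i.2.2⟩).1, key φ _ i.2.1, (φ _).2.2⟩
  have hf : StrictMono f := fun i k hik => by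
    have : (⟨i.1, le_self_add.trans i.2.1, i.2.2⟩ : Set.Ico X.1.lo X.1.hi) <
        ⟨k.1, le_self_add.trans k.2.1, k.2.2⟩ := hik
    exact φ.lt_iff_lt.2 this
  have hs : Function.Surjective f := fun k => by
    refine ⟨⟨(φ.symm ⟨k.1, le_self_add.trans k.2.1, k.2.2⟩).1, key φ.symm _ k.2.1,
      (φ.symm _).2.2⟩, Subtype.ext ?_⟩
    change (φ (φ.symm ⟨k.1, le_self_add.trans k.2.1, k.2.2⟩)).1 = k.1
    rw [OrderIso.apply_symm_apply]
  exact ⟨hf.orderIsoOfSurjective f hs, fun i => h _⟩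

theorem PreInfSkand.equal_of_head_next {U : Type (u + 1)} {X Y : PreInfSkand U}
    (h₀ : X.1.head = Y.1.head) (h₁ : X.next.1.Equal Y.next.1) : X.1.Equal Y.1 := by
  classical
  obtain ⟨ψ, h⟩ := h₁
  have up : ∀ {Z : Skand U} (i : Set.Ico Z.lo Z.hi), i.1 ≠ Z.lo → Z.lo + 1 ≤ i.1 := fun i hi =>
    Order.add_one_le_iff.2 (lt_of_le_of_ne i.2.1 hi.symm)
  have low : ∀ i, Y.1.lo < (ψ i).1 := fun i => Order.add_one_le_iff.1 (ψ i).2.1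
  let f : Set.Ico X.1.lo X.1.hi → Set.Ico Y.1.lo Y.1.hi := fun i =>
    if hi : i.1 = X.1.lo then ⟨Y.1.lo, le_rfl, Y.1.lo_lt_hi⟩
    else ⟨(ψ ⟨i.1, up i hi, i.2.2⟩).1, (low _).le, (ψ _).2.2⟩
  have f_lo : ∀ i, i.1 = X.1.lo → f i = ⟨Y.1.lo, le_rfl, Y.1.lo_lt_hi⟩ := fun i hi => dif_pos hi
  have f_up : ∀ i (hi : i.1 ≠ X.1.lo),
      f i = ⟨(ψ ⟨i.1, up i hi, i.2.2⟩).1, (low _).le, (ψ _).2.2⟩ := fun i hi => dif_neg hi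
  have hf : StrictMono f := fun i k hik => by
    have hk : k.1 ≠ X.1.lo := (lt_of_le_of_lt i.2.1 hik).ne'
    rw [f_up k hk]
    by_cases hi : i.1 = X.1.lo
    · rw [f_lo i hi]
      exact low _
    · rw [f_up i hi]
      exact ψ.lt_iff_lt.2 hik
  have hs : Function.Surjective f := fun k => by
    by_cases hk : k.1 = Y.1.lo
    · exact ⟨⟨X.1.lo, le_rfl, X.1.lo_lt_hi⟩, by rw [f_lo _ rfl]; exact Subtype.ext hk.symm⟩
    · have hne : (ψ.symm ⟨k.1, up k hk, k.2.2⟩).1 ≠ X.1.lo :=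
        (Order.add_one_le_iff.1 (ψ.symm ⟨k.1, up k hk, k.2.2⟩).2.1).ne'
      refine ⟨⟨(ψ.symm ⟨k.1, up k hk, k.2.2⟩).1,
        le_self_add.trans (ψ.symm ⟨k.1, up k hk, k.2.2⟩).2.1, (ψ.symm _).2.2⟩, ?_⟩
      rw [f_up _ hne]
      apply Subtype.ext
      change (ψ (ψ.symm ⟨k.1, up k hk, k.2.2⟩)).1 = k.1
      rw [OrderIso.apply_symm_apply]
  refine ⟨hf.orderIsoOfSurjective f hs, fun i => ?_⟩
  change X.1.comp i = Y.1.comp (f i)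
  by_cases hi : i.1 = X.1.lo
  · rw [f_lo i hi]
    have : i = ⟨X.1.lo, le_rfl, X.1.lo_lt_hi⟩ := Subtype.ext hi
    rw [this]
    exact h₀
  · rw [f_up i hi]
    exact h ⟨i.1, up i hi, i.2.2⟩

/-! ### Universes of set theory with individuals and without foundation -/

/-- A universe of set theory with individuals `U`, classes, and no axiom of foundation. Sets are
the elements that are not individuals; classes are all subsets of `carrier`. Individuals have no
members, sets are extensional, and a class is (the extension of) a set exactly when it is small.
Since smallness is closed under subclasses, images, pairs, small unions and power sets,
`exists_set` comprises the usual set existence axioms. -/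
structure SetUniverse (U : Type (u + 1)) : Type (u + 2) where
  carrier : Type (u + 1)
  Mem : carrier → carrier → Prop
  indiv : U → carrier
  indiv_injective : Function.Injective indiv
  not_mem_indiv : ∀ a y, ¬ Mem y (indiv a)
  ext : ∀ x y, x ∉ Set.range indiv → y ∉ Set.range indiv → (∀ z, Mem z x ↔ Mem z y) → x = y
  small_mem : ∀ x, Small.{u} {y | Mem y x}
  exists_set : ∀ C : Set carrier, Small.{u} C → ∃ x, x ∉ Set.range indiv ∧ ∀ y, Mem y x ↔ y ∈ C

namespace SetUniverse

variable {U : Type (u + 1)}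

/-- `x` is a set, not an individual. -/
def IsSet (V : SetUniverse U) (x : V.carrier) : Prop := x ∉ Set.range V.indiv

/-- `X ∈ X`. -/
def IsReflexive (V : SetUniverse U) (X : V.carrier) : Prop := V.IsSet X ∧ V.Mem X X

/-- `X = {x₀, x₁, …, X}`, where `x₀, x₁, …` are the elements of `A`. -/
def IsSolution (V : SetUniverse U) (A X : V.carrier) : Prop :=
  V.IsSet X ∧ ∀ y, V.Mem y X ↔ V.Mem y A ∨ y = X

/-- A class is proper if it is not the extension of a set. -/
def IsProperClass (V : SetUniverse U) (C : Set V.carrier) : Prop :=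
  ¬ ∃ s, V.IsSet s ∧ ∀ y, V.Mem y s ↔ y ∈ C

/-- An inclusion of a universe as a transitive part of another one with the same individuals. -/
structure Inclusion (V W : SetUniverse U) where
  toFun : V.carrier → W.carrier
  injective : Function.Injective toFun
  map_indiv : ∀ a, toFun (V.indiv a) = W.indiv a
  mem_iff : ∀ x y, W.Mem y (toFun x) ↔ ∃ z, V.Mem z x ∧ y = toFun z

/-- Every universe is included in itself. -/
def Inclusion.refl (V : SetUniverse U) : Inclusion V V where
  toFun := id
  injective := Function.injective_id
  map_indiv _ := rfl
  mem_iff x y := ⟨fun h => ⟨y, h, rfl⟩, fun ⟨_, h, e⟩ => e ▸ h⟩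

end SetUniverse

/-! ### The universe generated by the well-founded sets and the skands

Infinite skands are adjoined to well-founded set theory as additional "pseudo-individuals", but a
skand `X_(a, b)` has as members the elements of its first component and the skand `X_(a+1, b)`. -/

/-- Well-founded sets over the individuals and the infinite skands. -/
abbrev Raw (U : Type (u + 1)) : Type (u + 1) := HSet (U ⊕ InfSkand U)

namespace Raw

variable {U : Type (u + 1)}

/-- A well-founded set or an individual, seen in the larger universe. -/
def ofHSet (x : HSet U) : Raw U := x.map Sum.inl

/-- A skand of infinite length. -/
def ofSkand (X : PreInfSkand U) : Raw U := HSet.atom (Sum.inr (Quotient.mk _ X))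

/-- Membership, where skands are regarded as sets. -/
def Mem (y x : Raw U) : Prop :=
  HSet.Mem y x ∨
    ∃ X : PreInfSkand U, x = ofSkand X ∧ (HSet.Mem y (ofHSet X.1.head.1) ∨ y = ofSkand X.next)

/-- Strong extensionality identifies a set having the same members as a skand with this skand.
The normal elements are those which, hereditarily, represent such a set only by the skand. -/
inductive Normal : Raw U → Prop
  | intro (x : Raw U) (hx : ∀ y, HSet.Mem y x → Normal y)
      (hs : x.IsSet → ∀ X : PreInfSkand U, ¬ ∀ y, Mem y x ↔ Mem y (ofSkand X)) : Normal x

theorem ofSkand_eq_iff {X Y : PreInfSkand U} : ofSkand X = ofSkand Y ↔ X.1.Equal Y.1 :=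
  ⟨fun h => Quotient.exact (Sum.inr_injective (HSet.atom_injective h)),
    fun h => congrArg (fun q => HSet.atom (Sum.inr q)) (Quotient.sound h)⟩

theorem mem_ofSkand {X : PreInfSkand U} {y : Raw U} :
    Mem y (ofSkand X) ↔ HSet.Mem y (ofHSet X.1.head.1) ∨ y = ofSkand X.next := by
  constructor
  · rintro (h | ⟨Y, e, h⟩)
    · exact (HSet.not_mem_atom _ _ h).elim
    · have e' := ofSkand_eq_iff.1 e
      rw [PreInfSkand.head_eq e', ofSkand_eq_iff.2 (PreInfSkand.next_equal e')]
      exact h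
  · intro h
    exact Or.inr ⟨X, rfl, h⟩

theorem mem_of_isSet {x y : Raw U} (hx : x.IsSet) : Mem y x ↔ HSet.Mem y x := by
  refine ⟨?_, Or.inl⟩
  rintro (h | ⟨X, rfl, _⟩)
  · exact h
  · obtain ⟨ι, f, h⟩ := hx
    exact (HSet.atom_ne_mk _ _ _ h).elim

theorem not_mem_inl (a : U) (y : Raw U) : ¬ Mem y (HSet.atom (Sum.inl a)) := by
  rintro (h | ⟨X, h, _⟩)
  · exact HSet.not_mem_atom _ _ h
  · exact Sum.inl_ne_inr (HSet.atom_injective h)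

theorem ofHSet_ne_ofSkand (x : HSet U) (X : PreInfSkand U) : ofHSet x ≠ ofSkand X := by
  rcases HSet.atom_or_mk x with ⟨a, rfl⟩ | h
  · exact fun h => Sum.inl_ne_inr (HSet.atom_injective h)
  · obtain ⟨ι, f, h⟩ := HSet.isSet_map (Sum.inl : U → U ⊕ InfSkand U) h
    exact fun e => HSet.atom_ne_mk _ _ _ (e.symm.trans h)

theorem ofSkand_notMem (x : HSet U) (X : PreInfSkand U) : ¬ HSet.Mem (ofSkand X) (ofHSet x) := by
  intro h
  obtain ⟨z, _, e⟩ := (HSet.mem_map _).1 h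
  exact ofHSet_ne_ofSkand z X e.symm

theorem normal_atom (a : U ⊕ InfSkand U) : Normal (HSet.atom a : Raw U) :=
  Normal.intro _ (fun _ h => (HSet.not_mem_atom _ _ h).elim)
    fun ⟨_, _, h⟩ => (HSet.atom_ne_mk _ _ _ h).elim

theorem normal_ofHSet (x : HSet U) : Normal (ofHSet x) := by
  induction x using HSet.induction with
  | ha a => exact normal_atom _
  | hs x hx ih =>
    refine Normal.intro _ (fun y hy => ?_) fun h X e => ?_
    · obtain ⟨z, hz, rfl⟩ := (HSet.mem_map _).1 hy
      exact ih z hz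
    · have := (e (ofSkand X.next)).2 (mem_ofSkand.2 (Or.inr rfl))
      exact ofSkand_notMem x _ ((mem_of_isSet h).1 this)

theorem Normal.of_mem {x y : Raw U} (hx : Normal x) (h : Mem y x) : Normal y := by
  rcases h with h | ⟨X, rfl, h | rfl⟩
  · cases hx with
    | intro _ hx _ => exact hx y h
  · obtain ⟨z, _, rfl⟩ := (HSet.mem_map _).1 h
    exact normal_ofHSet z
  · exact normal_atom _

theorem cases (x : Raw U) :
    (∃ a, x = HSet.atom (Sum.inl a)) ∨ (∃ X : PreInfSkand U, x = ofSkand X) ∨ x.IsSet := by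
  rcases HSet.atom_or_mk x with ⟨a | q, rfl⟩ | h
  · exact Or.inl ⟨a, rfl⟩
  · obtain ⟨X, rfl⟩ := Quotient.exists_rep q
    exact Or.inr (Or.inl ⟨X, rfl⟩)
  · exact Or.inr (Or.inr h)

theorem equal_of_mem_iff {X Y : PreInfSkand U}
    (h : ∀ y, Mem y (ofSkand X) ↔ Mem y (ofSkand Y)) : ofSkand X = ofSkand Y := by
  simp only [mem_ofSkand] at h
  have hh : ofHSet X.1.head.1 = ofHSet Y.1.head.1 := by
    refine HSet.ext_of_isSet (HSet.isSet_map _ X.1.head.2) (HSet.isSet_map _ Y.1.head.2)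
      fun z => ⟨fun hz => ?_, fun hz => ?_⟩
    · rcases (h z).1 (Or.inl hz) with h' | rfl
      · exact h'
      · exact (ofSkand_notMem _ _ hz).elim
    · rcases (h z).2 (Or.inl hz) with h' | rfl
      · exact h'
      · exact (ofSkand_notMem _ _ hz).elim
  have hn : ofSkand X.next = ofSkand Y.next :=
    ((h _).1 (Or.inr rfl)).resolve_left (ofSkand_notMem _ _)
  have hinj : Function.Injective (ofHSet : HSet U → Raw U) := HSet.map_injective Sum.inl_injective
  exact ofSkand_eq_iff.2
    (PreInfSkand.equal_of_head_next (Subtype.ext (hinj hh)) (ofSkand_eq_iff.1 hn))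

theorem ext_of_normal {x y : Raw U} (hx : Normal x) (hy : Normal y)
    (hx' : ∀ a, x ≠ HSet.atom (Sum.inl a)) (hy' : ∀ a, y ≠ HSet.atom (Sum.inl a))
    (h : ∀ z, Mem z x ↔ Mem z y) : x = y := by
  rcases cases x with ⟨a, e⟩ | ⟨X, rfl⟩ | sx
  · exact (hx' a e).elim
  · rcases cases y with ⟨a, e⟩ | ⟨Y, rfl⟩ | sy
    · exact (hy' a e).elim
    · exact equal_of_mem_iff h
    · cases hy with
      | intro _ _ hs => exact (hs sy X fun z => (h z).symm).elim
  · rcases cases y with ⟨a, e⟩ | ⟨Y, rfl⟩ | sy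
    · exact (hy' a e).elim
    · cases hx with
      | intro _ _ hs => exact (hs sx Y h).elim
    · refine HSet.ext_of_isSet sx sy fun z => ?_
      rw [← mem_of_isSet sx, ← mem_of_isSet sy, h]

theorem small_mem (x : Raw U) : Small.{u} {y | Mem y x} := by
  rcases cases x with ⟨a, rfl⟩ | ⟨X, rfl⟩ | sx
  · have : {y | Mem y (HSet.atom (Sum.inl a))} = (∅ : Set (Raw U)) :=
      Set.eq_empty_of_forall_notMem fun y => not_mem_inl a y
    rw [this]
    infer_instance
  · have : {y | Mem y (ofSkand X)} =
        {y | HSet.Mem y (ofHSet X.1.head.1)} ∪ {ofSkand X.next} := by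
      ext y
      exact mem_ofSkand
    rw [this]
    have := HSet.small_mem (ofHSet X.1.head.1)
    infer_instance
  · have : {y | Mem y x} = {y | HSet.Mem y x} := by
      ext y
      exact mem_of_isSet sx
    rw [this]
    exact HSet.small_mem x

theorem exists_normal (C : Set (Raw U)) [Small.{u} C] (hC : ∀ y ∈ C, Normal y) :
    ∃ x : Raw U, Normal x ∧ (∀ a, x ≠ HSet.atom (Sum.inl a)) ∧ ∀ y, Mem y x ↔ y ∈ C := by
  obtain ⟨x, sx, hx⟩ := HSet.exists_of_small C
  by_cases h : ∃ X : PreInfSkand U, ∀ y, Mem y x ↔ Mem y (ofSkand X)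
  · obtain ⟨X, h⟩ := h
    refine ⟨ofSkand X, normal_atom _, fun a e => ?_, fun y => ?_⟩
    · exact Sum.inl_ne_inr (HSet.atom_injective e).symm
    · rw [← h, mem_of_isSet sx, hx]
  · refine ⟨x, Normal.intro x (fun y hy => hC y ((hx y).1 hy)) fun _ X e => h ⟨X, e⟩,
      fun a e => ?_, fun y => ?_⟩
    · obtain ⟨ι, f, e'⟩ := sx
      exact HSet.atom_ne_mk _ _ _ (e.symm.trans e')
    · rw [mem_of_isSet sx, hx]

end Raw

/-- The universe generated by the individuals, the well-founded sets and all skands. -/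
def skandUniverse (U : Type (u + 1)) : SetUniverse U where
  carrier := {x : Raw U // x.Normal}
  Mem y x := Raw.Mem y.1 x.1
  indiv a := ⟨HSet.atom (Sum.inl a), Raw.normal_atom _⟩
  indiv_injective _ _ h := Sum.inl_injective (HSet.atom_injective (congrArg Subtype.val h))
  not_mem_indiv a y := Raw.not_mem_inl a y.1
  ext x y hx hy h :=
    Subtype.ext <| Raw.ext_of_normal x.2 y.2
      (fun a e => hx ⟨a, Subtype.ext e.symm⟩) (fun a e => hy ⟨a, Subtype.ext e.symm⟩)
      fun z => ⟨fun hz => (h ⟨z, x.2.of_mem hz⟩).1 hz, fun hz => (h ⟨z, y.2.of_mem hz⟩).2 hz⟩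
  small_mem x := by
    have := Raw.small_mem x.1
    exact small_of_injective (β := {y | Raw.Mem y x.1})
      (f := fun y : {y : {x : Raw U // x.Normal} | Raw.Mem y.1 x.1} => ⟨y.1.1, y.2⟩)
      fun y z h => Subtype.ext (Subtype.ext (congrArg (fun w => w.1) h))
  exists_set C hC := by
    obtain ⟨x, hx, ha, h⟩ := Raw.exists_normal (Subtype.val '' C) (by
      rintro _ ⟨y, _, rfl⟩
      exact y.2)
    refine ⟨⟨x, hx⟩, ?_, fun y => (h y.1).trans ?_⟩
    · rintro ⟨a, e⟩
      exact ha a (congrArg Subtype.val e).symm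
    · exact Subtype.val_injective.mem_set_image

/-- A well-founded set as an element of `skandUniverse U`. -/
def ofWFSet {U : Type (u + 1)} (A : WFSet U) : (skandUniverse U).carrier :=
  ⟨Raw.ofHSet A.1, Raw.normal_ofHSet A.1⟩

/-- A skand of infinite length as an element of `skandUniverse U`. -/
def ofSkand {U : Type (u + 1)} (X : Skand U) (hX : X.IsInfinite) : (skandUniverse U).carrier :=
  ⟨Raw.ofSkand ⟨X, hX⟩, Raw.normal_atom _⟩

/-- The skand of length `ω ^ κ` all of whose components are equal to `A`. -/
noncomputable def powSkand {U : Type (u + 1)} (A : WFSet U) (κ : Ordinal.{u}) : Skand U :=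
  Skand.const A (Ordinal.omega0 ^ κ) (Ordinal.opow_pos κ Ordinal.omega0_pos)

theorem powSkand_isInfinite {U : Type (u + 1)} (A : WFSet U) {κ : Ordinal.{u}} (hκ : 1 ≤ κ) :
    (powSkand A κ).IsInfinite := by
  change 0 + Ordinal.omega0 ≤ Ordinal.omega0 ^ κ
  rw [zero_add]
  exact Ordinal.left_le_opow _ (lt_of_lt_of_le zero_lt_one hκ)

end Skands

namespace Skands

variable {U : Type (u + 1)}

/-! The ordinal `ω ^ κ` is additively indecomposable: for `a < ω ^ κ`, left translation `i ↦ a + i`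
maps `[0, ω ^ κ)` isomorphically onto `[a, ω ^ κ)`. A skand of this length with all components `A`
is therefore equal to each of its tails (`isSelfSimilar_const`). For `κ ≥ 1` it is infinite, so as a
set it consists of the elements of `A` and of its tail from index `1`. That tail is the skand
itself, which gives `X = A ∪ {X}` and in particular `X ∈ X`.

Equal skands have isomorphic index segments, hence constant skands starting at `0` that are equal
have the same length (`const_length_eq`). As `κ ↦ ω ^ κ` is strictly increasing, different exponents
give different solutions. The ordinals thus embed into the class of solutions, which cannot be
small. All of this is proved in `skandUniverse U` and carried to a larger universe by the inclusion
`j`, which is injective and has transitive image. -/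

/-- A strictly monotone map does not decrease the length of an initial segment of ordinals. -/
theorem le_of_strictMono_Ico {a b : Ordinal.{u}} (f : Set.Ico 0 a → Set.Ico 0 b)
    (hf : StrictMono f) : a ≤ b := by
  have key : ∀ (o : Ordinal.{u}) (ho : o ∈ Set.Ico 0 a), o ≤ (f ⟨o, ho⟩).1 := by
    intro o
    induction o using WellFoundedLT.induction with
    | _ o ih =>
      intro ho
      by_contra! hlt
      -- If `f o < o`, then `f` can be applied again: monotonicity gives `f (f o) < f o`, while the
      -- induction hypothesis at `f o` gives `f o ≤ f (f o)`.
      have hm : (f ⟨o, ho⟩).1 ∈ Set.Ico 0 a := ⟨zero_le, hlt.trans ho.2⟩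
      exact (ih _ hlt hm).not_gt (hf (show (⟨_, hm⟩ : Set.Ico 0 a) < ⟨o, ho⟩ from hlt))
  by_contra! hba
  -- If `b < a`, then `b` is in the domain, and `b ≤ f b` contradicts that the values lie below `b`.
  exact (key b ⟨zero_le, hba⟩).not_gt (f ⟨b, zero_le, hba⟩).2.2

/-! ### Constant skands: length and self-similarity -/

namespace Skand

theorem Equal.const_length_eq {A B : WFSet U} {a b : Ordinal.{u}} {ha : 0 < a} {hb : 0 < b}
    (h : (const A a ha).Equal (const B b hb)) : a = b := by
  obtain ⟨φ, _⟩ := h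
  exact le_antisymm (le_of_strictMono_Ico _ φ.strictMono)
    (le_of_strictMono_Ico _ φ.symm.strictMono)

/-- A constant skand of additively indecomposable length is self-similar. -/
theorem isSelfSimilar_const (A : WFSet U) {o : Ordinal.{u}} (ho : 0 < o)
    (hp : Ordinal.IsPrincipal (· + ·) o) : (const A o ho).IsSelfSimilar := by
  intro a _ ha
  change a < o at ha
  -- Indecomposability is what keeps `a + i` below `o`. The shift has to be on the left, since `i ↦
  -- i + a` need not be strictly monotone.
  let f : Set.Ico 0 o → Set.Ico a o := fun i => ⟨a + i.1, le_self_add, hp ha i.2.2⟩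
  have hf : StrictMono f := fun i k hik => (add_lt_add_iff_left a).2 hik
  have hs : Function.Surjective f := fun k =>
    -- Ordinal subtraction inverts left addition: `a + (k - a) = k` because `a ≤ k`.
    ⟨⟨k.1 - a, zero_le, (Ordinal.sub_le_self _ _).trans_lt k.2.2⟩,
      Subtype.ext (Ordinal.add_sub_cancel_of_le k.2.1)⟩
  exact ⟨hf.orderIsoOfSurjective f hs, fun _ => rfl⟩

end Skand

theorem powSkand_isSelfSimilar (A : WFSet U) (κ : Ordinal.{u}) : (powSkand A κ).IsSelfSimilar :=
  Skand.isSelfSimilar_const A _ (Ordinal.isPrincipal_add_omega0_opow κ)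

/-! ### Self-similar skands as solutions -/

/-- In `Raw U` a skand is an atom too, but one tagged `Sum.inr`, whereas the genuine individuals are
tagged `Sum.inl`. -/
theorem isSet_ofSkand (X : Skand U) (hX : X.IsInfinite) :
    (skandUniverse U).IsSet (ofSkand X hX) := by
  rintro ⟨a, e⟩
  exact Sum.inl_ne_inr (HSet.atom_injective (congrArg Subtype.val e))

theorem Raw.mem_ofSkand_of_isSelfSimilar {X : PreInfSkand U} (hs : X.1.IsSelfSimilar) {y : Raw U} :
    Raw.Mem y (Raw.ofSkand X) ↔ Raw.Mem y (Raw.ofHSet X.1.head.1) ∨ y = Raw.ofSkand X := by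
  -- Only the first tail matters here: it is the single element that the skand has besides those of
  -- its head.
  have hnext : Raw.ofSkand X = Raw.ofSkand X.next :=
    Raw.ofSkand_eq_iff.2 (hs _ le_self_add X.next.1.lo_lt_hi)
  have hset : (Raw.ofHSet X.1.head.1).IsSet := HSet.isSet_map _ X.1.head.2
  rw [Raw.mem_ofSkand, ← hnext, Raw.mem_of_isSet hset]

/-- A self-similar skand of infinite length solves the equation given by its first component. -/
theorem Skand.IsSelfSimilar.isSolution {X : Skand U} (hs : X.IsSelfSimilar) (hX : X.IsInfinite) :
    (skandUniverse U).IsSolution (ofWFSet X.head) (ofSkand X hX) :=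
  ⟨isSet_ofSkand X hX, fun _ => (Raw.mem_ofSkand_of_isSelfSimilar (X := ⟨X, hX⟩) hs).trans
    (or_congr_right ⟨fun h => Subtype.ext h, fun h => congrArg Subtype.val h⟩)⟩

/-! ### Transfer to larger universes and proper classes -/

namespace SetUniverse

theorem Inclusion.isSet {V W : SetUniverse U} (j : Inclusion V W) {x : V.carrier}
    (hx : V.IsSet x) : W.IsSet (j.toFun x) := by
  rintro ⟨a, e⟩
  exact hx ⟨a, j.injective ((j.map_indiv a).trans e)⟩

/-- Transitivity of the image is essential: every member of `j.toFun X` comes from a member of `X`,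
so the larger universe adds no elements to either side of the equation. -/
theorem Inclusion.isSolution {V W : SetUniverse U} (j : Inclusion V W) {A X : V.carrier}
    (h : V.IsSolution A X) : W.IsSolution (j.toFun A) (j.toFun X) := by
  refine ⟨j.isSet h.1, fun y => ?_⟩
  rw [j.mem_iff, j.mem_iff]
  simp only [h.2, or_and_right, exists_or, exists_eq_left]

theorem IsSolution.isReflexive {V : SetUniverse U} {A X : V.carrier} (h : V.IsSolution A X) :
    V.IsReflexive X :=
  ⟨h.1, (h.2 X).2 (Or.inr rfl)⟩

/-- A class into which the ordinals embed is proper. -/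
theorem isProperClass_of_injective {V : SetUniverse U} {C : Set V.carrier}
    (f : Ordinal.{u} → V.carrier) (hf : Function.Injective f) (hC : ∀ o, f o ∈ C) :
    V.IsProperClass C := by
  rintro ⟨s, _, hs⟩
  have := V.small_mem s
  -- The extension of a set is `u`-small, and smallness would pass to the ordinals along the
  -- injection.
  have : Small.{u} Ordinal.{u} :=
    small_of_injective (β := {y | V.Mem y s}) (f := fun o => ⟨f o, (hs _).2 (hC o)⟩)
      fun a b h => hf (congrArg Subtype.val h)
  exact not_small_ordinal.{u, u} this

end SetUniverse

theorem isSolution_powSkand (A : WFSet U) {κ : Ordinal.{u}} (hκ : 1 ≤ κ) :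
    (skandUniverse U).IsSolution (ofWFSet A) (ofSkand (powSkand A κ) (powSkand_isInfinite A hκ)) :=
  (powSkand_isSelfSimilar A κ).isSolution (powSkand_isInfinite A hκ)

theorem ofSkand_powSkand_inj (A : WFSet U) {κ κ' : Ordinal.{u}} (hκ : 1 ≤ κ) (hκ' : 1 ≤ κ')
    (h : ofSkand (powSkand A κ) (powSkand_isInfinite A hκ) =
      ofSkand (powSkand A κ') (powSkand_isInfinite A hκ')) : κ = κ' :=
  (Ordinal.isNormal_opow Ordinal.one_lt_omega0).strictMono.injective
    (Raw.ofSkand_eq_iff.1 (congrArg Subtype.val h)).const_length_eq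

/-- The empty well-founded set. -/
noncomputable def emptyWFSet (U : Type (u + 1)) : WFSet U := ⟨HSet.mk PEmpty PEmpty.elim, _, _, rfl⟩

end Skands

open Skands in
theorem proposition1 (U : Type (u + 1)) :
    (∃ X, (skandUniverse U).IsReflexive X) ∧
    ∀ (V : SetUniverse U) (j : SetUniverse.Inclusion (skandUniverse U) V),
      (∃ X, V.IsReflexive X) ∧
      ∀ A : WFSet U,
        V.IsProperClass {X | V.IsSolution (j.toFun (ofWFSet A)) X} ∧
        (∀ (κ : Ordinal.{u}) (hκ : 1 ≤ κ),
          (powSkand A κ).IsSelfSimilar ∧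
          V.IsSolution (j.toFun (ofWFSet A))
            (j.toFun (ofSkand (powSkand A κ) (powSkand_isInfinite A hκ)))) ∧
        (∀ (κ κ' : Ordinal.{u}) (hκ : 1 ≤ κ) (hκ' : 1 ≤ κ'), κ ≠ κ' →
          j.toFun (ofSkand (powSkand A κ) (powSkand_isInfinite A hκ)) ≠
            j.toFun (ofSkand (powSkand A κ') (powSkand_isInfinite A hκ'))) := by
  have reflexive : ∀ (V : SetUniverse U), SetUniverse.Inclusion (skandUniverse U) V →
      ∃ X, V.IsReflexive X := fun V j =>
    -- The witness is the skand of length `ω` with empty components, which satisfies `X = {X}`.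
    ⟨_, (j.isSolution (isSolution_powSkand (emptyWFSet U) (le_refl 1))).isReflexive⟩
  refine ⟨reflexive _ (.refl _), fun V j => ⟨reflexive V j, fun A => ⟨?_, fun κ hκ => ?_, ?_⟩⟩⟩
  · refine SetUniverse.isProperClass_of_injective
      -- The exponent `1 + o` avoids `κ = 0`, where the length `ω ^ 0 = 1` is finite. Addition of
      -- `1` on the left is injective.
      (fun o => j.toFun (ofSkand (powSkand A (1 + o)) (powSkand_isInfinite A le_self_add)))
      (fun a b h => ?_) fun o => j.isSolution (isSolution_powSkand A le_self_add)
    exact add_left_cancel (ofSkand_powSkand_inj A le_self_add le_self_add (j.injective h))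
  · exact ⟨powSkand_isSelfSimilar A κ, j.isSolution (isSolution_powSkand A hκ)⟩
  · exact fun κ κ' hκ hκ' hne h => hne (ofSkand_powSkand_inj A hκ hκ' (j.injective h))
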